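/- **Setting.** For integers $n,m\ge 1$ one observes $Z=(Y_1,\dots,Y_n,X_1,\dots,X_m)\in\mathbb R^{n+m}$ with law $P\in\mathcal P_{n,m}$, where $\mathcal P_{n,m}$ is the set of all laws $P=P_0^{\otimes n}\otimes P_1\otimes\dots\otimes P_m$ such that each $P_i$, $0\le i\le m$, is a continuous (i.e. atomless) probability distribution on $\mathbb R$. Let $\mathcal H_0(P)=\{i\in\{1,\dots,m\}: P_i=P_0\}$, let $\mathcal H_1(P)$ be its complement in $\{1,\dots,m\}$, $m_1(P)=|\mathcal H_1(P)|$, $\mathcal A_{n,m}=\{P\in\mathcal P_{n,m}: m_1(P)\ge 1\}$, and $F_0(t)=P_0([t,\infty))$. A procedure $R$ is a family, indexed by $n,m\geq 1$, of measurable functions $Z\mapsto R(Z)\subset\{1,\dots,m\}$ (not depending on $P$). For a (possibly $P$-dependent) rejection set $R$ set $\mathrm{FDP}(P,R)=\frac{|\mathcal H_0(P)\cap R|}{1\vee|R|}$, $\mathrm{FDR}(P,R)=\mathbb E_{Z\sim P}[\mathrm{FDP}(P,R(Z))]$ and $\mathrm{TDP}(P,R)=\frac{|\mathcal H_1(P)\cap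 R|}{1\vee m_1(P)}$. The BH procedure at level $\alpha$ applied to $p$-values $p_1,\dots,p_m$, with ordered values $p_{(1)}\le\dots\le p_{(m)}$ and $p_{(0)}=0$, is $\{i: p_i\le\alpha\hat k/m\}$ with $\hat k=\max\{k\in\{0,\dots,m\}: p_{(k)}\le\alpha k/m\}$. The oracle $\mathrm{BH}^*_\alpha$ is the BH procedure applied to $p_i=F_0(X_i)$; the semi-supervised BH procedure $\widehat{\mathrm{BH}}_\alpha$ is the BH procedure applied to $\hat p_i=\big(1+\#\{j: Y_j\ge X_i\}\big)/(n+1)$. A procedure $R$ is $MO(\gamma,\alpha,\eta,\delta_1,\delta_2)$ if $$\sup_{n,m\ge1,\ n\ge m\gamma}\ \sup_{P\in\mathcal P_{n,m}}\{\mathrm{FDR}(P,R)-\mathrm{FDR}(P,\mathrm{BH}^*_\alpha)\}\le\delta_1$$ and $$\sup_{n,m\ge1,\ n\ge m\gamma}\ \sup_{P\in\mathcal A_{n,m}}\mathbb P_{Z\sim P}\big(\mathrm{TDP}(P,\mathrm{BH}^*_{\alpha(1-\eta)})>\mathrm{TDP}(P,R)\big)\le\delta_2 .$$ **Statement.** Let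 $\alpha\in(0,1/4)$, $\eta\in(0,1)$, $$\gamma^*(\alpha,\eta)=\alpha^{-1}\eta^{-2}(1+\eta)\,28\log 2,\qquad \gamma_*(\alpha,\eta)=\frac{\big(1+(\alpha(1-\eta))^{-1/2}\big)^{-3}}{64}.$$ Then for every $\gamma>0$: (i) If $\gamma<\gamma_*(\alpha,\eta)$, then for all $\delta_1,\delta_2\in(0,1/4]$ there is no $MO(\gamma,\alpha,\eta,\delta_1,\delta_2)$ procedure. More generally, there is none for any $\delta_1<\frac12-\alpha$ and $\delta_2<\frac12-\frac14\big(\gamma/\gamma_*(\alpha,\eta)\big)^{1/3}$. (ii) If $\gamma\ge\gamma^*(\alpha,\eta)$, then there exists an $MO(\gamma,\alpha,\eta,\delta_1,\delta_2)$ procedure for some $\delta_1,\delta_2\in[0,1/4]$. Specifically, $\widehat{\mathrm{BH}}_\alpha$ is $MO(\gamma,\alpha,\eta,\delta_1,\delta_2)$ with $\delta_1=0$ and $\delta_2=(1/2)^{3\gamma/\gamma^*(\alpha,\eta)-1}$. -/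

import Mathlib

noncomputable section

open MeasureTheory Set
open scoped Classical

namespace SemiSupervised

/-- The observation space `ℝ ^ (n + m)`: a point `z = (y, x)` consists of the null training sample
`y = (Y_1, …, Y_n)` and of the test sample `x = (X_1, …, X_m)`. -/
abbrev Sample (n m : ℕ) : Type := (Fin n → ℝ) × (Fin m → ℝ)

/-- The parameters of a distribution of the form `P_0 ^ {⊗ n} ⊗ P_1 ⊗ ⋯ ⊗ P_m`, where
`P_0, P_1, …, P_m` are continuous (that is, atomless) probability distributions on `ℝ`.
For `n ≥ 1`, the marginals are determined by the product measure, so that for such an `n` these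
parameters are the same as the elements of the class of all distributions of that form. -/
structure Model (m : ℕ) where
  /-- the null distribution `P_0` -/
  null : Measure ℝ
  /-- the distributions `P_1, …, P_m` of the test statistics -/
  test : Fin m → Measure ℝ
  null_prob : IsProbabilityMeasure null
  test_prob : ∀ i, IsProbabilityMeasure (test i)
  null_cont : NullSingletonClass null
  test_cont : ∀ i, NullSingletonClass (test i)

attribute [instance] Model.null_prob Model.test_prob Model.null_cont Model.test_cont

/-- The distribution `P_0 ^ {⊗ n} ⊗ P_1 ⊗ ⋯ ⊗ P_m` of the sample. -/
def Model.law {m : ℕ} (P : Model m) (n : ℕ) : Measure (Sample n m) :=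
  (Measure.pi (fun _ : Fin n => P.null)).prod (Measure.pi P.test)

/-- The set of the indices of the true null hypotheses, `X_i ∼ P_0`. -/
def Model.H0 {m : ℕ} (P : Model m) : Finset (Fin m) :=
  Finset.univ.filter (fun i => P.test i = P.null)

/-- The set of the indices of the false null hypotheses. -/
def Model.H1 {m : ℕ} (P : Model m) : Finset (Fin m) := (P.H0)ᶜ

/-- The upper-tail function of the null distribution, `F_0(t) = P_0([t, ∞))`. -/
def Model.F0 {m : ℕ} (P : Model m) (t : ℝ) : ℝ := P.null.real (Ici t)

/-- The false discovery proportion of the rejection set `S`. -/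
def FDP {m : ℕ} (P : Model m) (S : Finset (Fin m)) : ℝ :=
  ((P.H0 ∩ S).card : ℝ) / max 1 (S.card : ℝ)

/-- The true discovery proportion of the rejection set `S`. -/
def TDP {m : ℕ} (P : Model m) (S : Finset (Fin m)) : ℝ :=
  ((P.H1 ∩ S).card : ℝ) / max 1 (P.H1.card : ℝ)

/-- The false discovery rate of the rejection rule `R` (the FDP takes values in `[0, 1]`). -/
def FDR {n m : ℕ} (P : Model m) (R : Sample n m → Finset (Fin m)) : ℝ :=
  ∫ z, FDP P (R z) ∂(P.law n)

/-- The order statistic `p_(k)` (the `k`-th smallest value, with multiplicity) for `1 ≤ k ≤ m`;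
it is `0` for `k = 0` by convention, and indices `k > m` are not used. -/
def orderStat {m : ℕ} (p : Fin m → ℝ) (k : ℕ) : ℝ :=
  if h : 1 ≤ k ∧ k ≤ m then p (Tuple.sort p ⟨k - 1, by omega⟩) else 0

/-- `max {k ∈ {0, …, m} : p_(k) ≤ α k / m}`; the index `k = 0` always belongs to this set. -/
def bhCount {m : ℕ} (α : ℝ) (p : Fin m → ℝ) : ℕ :=
  Nat.findGreatest (fun k => orderStat p k ≤ α * k / m) m

/-- The Benjamini–Hochberg procedure at level `α` applied to the p-values `p`. -/
def BH {m : ℕ} (α : ℝ) (p : Fin m → ℝ) : Finset (Fin m) :=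
  Finset.univ.filter (fun i => p i ≤ α * bhCount α p / m)

/-- The oracle BH procedure: BH with the p-values `F_0(X_i)`. -/
def oracleBH {n m : ℕ} (α : ℝ) (P : Model m) (z : Sample n m) : Finset (Fin m) :=
  BH α (fun i => P.F0 (z.2 i))

/-- The empirical p-values `(1 + #{j : Y_j ≥ X_i}) / (n + 1)`. -/
def empPValue {n m : ℕ} (z : Sample n m) (i : Fin m) : ℝ :=
  (1 + ((Finset.univ.filter (fun j : Fin n => z.2 i ≤ z.1 j)).card : ℝ)) / ((n : ℝ) + 1)

/-- The semi-supervised BH procedure: BH with the empirical p-values. -/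
def semiBH (α : ℝ) (n m : ℕ) (z : Sample n m) : Finset (Fin m) :=
  BH α (empPValue z)

/-- A multiple testing procedure, as a sequence in `n, m`: a measurable function of the sample
with values in the (finite) set of the subsets of the index set. It does not have access to the
unknown distribution. -/
def IsProcedure (R : ∀ n m : ℕ, Sample n m → Finset (Fin m)) : Prop :=
  ∀ (n m : ℕ) (S : Finset (Fin m)), MeasurableSet {z : Sample n m | R n m z = S}

/-- `R` is a procedure that `(δ₁, δ₂)`-mimics the oracle BH procedure, for a training-to-test sample
size ratio at least `γ`, and a level `α` with relaxation `η`. The bounds on the suprema over `n, m`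
and over the distributions are written out as bounds that are uniform in these; the bound on the
power is over the distributions with at least one false null hypothesis. -/
def IsMO (γ α η δ₁ δ₂ : ℝ) (R : ∀ n m : ℕ, Sample n m → Finset (Fin m)) : Prop :=
  IsProcedure R ∧
  (∀ n m : ℕ, 1 ≤ n → 1 ≤ m → (m : ℝ) * γ ≤ n → ∀ P : Model m,
    FDR P (R n m) - FDR P (oracleBH (n := n) α P) ≤ δ₁) ∧
  (∀ n m : ℕ, 1 ≤ n → 1 ≤ m → (m : ℝ) * γ ≤ n → ∀ P : Model m, 1 ≤ P.H1.card →
    (P.law n).real {z | TDP P (R n m z) < TDP P (oracleBH (α * (1 - η)) P z)} ≤ δ₂)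

/-- `γ^*(α, η) = α⁻¹ η⁻² (1 + η) 28 log 2`. -/
def gammaUpper (α η : ℝ) : ℝ := α⁻¹ * (η ^ 2)⁻¹ * (1 + η) * (28 * Real.log 2)

/-- `γ_*(α, η) = (1 + (α (1 - η)) ^ (-1/2)) ^ (-3) / 64`. -/
def gammaLower (α η : ℝ) : ℝ := ((1 + (α * (1 - η)) ^ (-(1 / 2) : ℝ)) ^ 3)⁻¹ / 64

end SemiSupervised

end

/-! Upper bound. The oracle has FDR exactly `α m₀ / m`: with the other p-values fixed, a uniform
null p-value meets its leave-one-out threshold `αK/m` with probability `αK/m` and then contributes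
`1/K` (`FDR_oracleBH`). The semi-supervised procedure stays below the same value. A null `X_i` is
exchangeable with the training sample, so its contribution may be averaged over the `n + 1`
exchanges, and that average is at most `α/m` for every sample (`sum_rejWeight_exchange_le`). Hence
`δ₁ = 0`. For the power, the relaxed oracle's rejections are all made by `semiBH` unless, for some
`k`, too many training points lie beyond the `k`-th relaxed threshold. A Chernoff bound makes this
probability at most `r ^ k`, where `r = (1/2) ^ (3γ/γ^*)`, and a geometric series sums the bounds.

Lower bound. Take a null contaminated with mass `ε` far in the tail. In the full-null model any
rejection is a false discovery, so `R` rejects something with probability at most `α + δ₁`. With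
probability `(1 - ε) ^ n` no training point is contaminated. On that event the sample is a mixture
of spiked models, where the contaminated test points are true signals that the oracle finds, so `R`
must reject with probability at least `1 - δ₂` as soon as there is one signal. This gives `IsMO.le`.
If `n/m` is small, `ε` can be chosen with `nε` small and `mε` large, and the inequality fails
(`not_isMO`). -/

noncomputable section

open MeasureTheory Set
open scoped Classical NNReal

namespace SemiSupervised

/-! ### Combinatorics of the step-up procedure. -/

section StepUp

variable {m : ℕ} {α : ℝ} {p q : Fin m → ℝ}

/-- Replaces sorting by counting; all later arguments about BH use only the counts. -/
lemma orderStat_le_iff (p : Fin m → ℝ) {k : ℕ} (hk : 1 ≤ k) (hkm : k ≤ m) (t : ℝ) :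
    orderStat p k ≤ t ↔ k ≤ (Finset.univ.filter (fun i => p i ≤ t)).card := by
  have h := Tuple.lt_card_le_iff_apply_le_of_monotone (j := (⟨k - 1, by omega⟩ : Fin m)) (a := t)
    (Tuple.monotone_sort p)
  have hc : (Finset.univ.filter (fun i => (p ∘ Tuple.sort p) i ≤ t)).card =
      (Finset.univ.filter (fun i => p i ≤ t)).card :=
    Finset.card_bijective (Tuple.sort p) (Tuple.sort p).bijective (by simp)
  have h' : orderStat p k = (p ∘ Tuple.sort p) ⟨k - 1, by omega⟩ := by
    simp [orderStat, hk, hkm]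
  rw [h', ← h, hc]
  simp only
  omega

lemma bhCount_le (α : ℝ) (p : Fin m → ℝ) : bhCount α p ≤ m := Nat.findGreatest_le _

/-- The defining inequality of the step-up index, through the number of small p-values. -/
lemma bhCount_le_card (α : ℝ) (p : Fin m → ℝ) :
    bhCount α p ≤ (BH α p).card := by
  rcases Nat.eq_zero_or_pos (bhCount α p) with h | h
  · omega
  · exact (orderStat_le_iff p h (bhCount_le α p) _).1
      (Nat.findGreatest_of_ne_zero (P := fun k => orderStat p k ≤ α * k / m) rfl h.ne')

lemma le_bhCount {k : ℕ} (hkm : k ≤ m)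
    (h : k ≤ (Finset.univ.filter (fun i => p i ≤ α * k / m)).card) : k ≤ bhCount α p := by
  rcases Nat.eq_zero_or_pos k with h0 | h0
  · omega
  · exact Nat.le_findGreatest hkm ((orderStat_le_iff p h0 hkm _).2 h)

/-- By maximality of the step-up index: every rejected p-value also meets the weaker threshold at `k
= |BH|`, so `|BH|` is itself an admissible index. -/
lemma card_BH (hα : 0 ≤ α) (p : Fin m → ℝ) : (BH α p).card = bhCount α p := by
  refine le_antisymm (le_bhCount ((Finset.card_le_univ _).trans (by simp)) ?_)
    (bhCount_le_card α p)
  refine Finset.card_le_card fun i hi => ?_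
  have hi' := (Finset.mem_filter.1 hi).2
  refine Finset.mem_filter.2 ⟨Finset.mem_univ _, hi'.trans ?_⟩
  have : (bhCount α p : ℝ) ≤ (BH α p).card := by exact_mod_cast bhCount_le_card α p
  gcongr

lemma mem_BH {i : Fin m} : i ∈ BH α p ↔ p i ≤ α * bhCount α p / m := by simp [BH]

lemma bhCount_anti (h : ∀ i, p i ≤ q i) : bhCount α q ≤ bhCount α p := by
  refine le_bhCount (bhCount_le α q) ((bhCount_le_card α q).trans (Finset.card_le_card ?_))
  intro i hi
  exact Finset.mem_filter.2 ⟨Finset.mem_univ _, (h i).trans (mem_BH.1 hi)⟩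

/-- A step-up comparison: if every rejection threshold for `p` at the level `β` that can occur is
also met by `q` at the level `α`, then all rejections for `p` are rejections for `q`. -/
lemma BH_subset_BH {β : ℝ} (hβ : 0 ≤ β) (hα : 0 ≤ α)
    (h : ∀ k : ℕ, 1 ≤ k → k ≤ m → ∀ i, p i ≤ β * k / m → q i ≤ α * k / m) :
    BH β p ⊆ BH α q := by
  intro i hi
  have hk : 1 ≤ bhCount β p := by
    rw [← card_BH hβ]; exact Finset.card_pos.2 ⟨i, hi⟩
  have hle : bhCount β p ≤ bhCount α q := by
    refine le_bhCount (bhCount_le β p) ((bhCount_le_card β p).trans (Finset.card_le_card ?_))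
    intro j hj
    exact Finset.mem_filter.2 ⟨Finset.mem_univ _, h _ hk (bhCount_le β p) j (mem_BH.1 hj)⟩
  refine mem_BH.2 ((h _ hk (bhCount_le β p) i (mem_BH.1 hi)).trans ?_)
  gcongr

lemma one_le_bhCount_update (hα : 0 ≤ α) (p : Fin m → ℝ) (i : Fin m) :
    1 ≤ bhCount α (Function.update p i 0) := by
  refine le_bhCount (Nat.one_le_iff_ne_zero.2 (by rintro rfl; exact i.elim0))
    (Finset.card_pos.2 ⟨i, ?_⟩)
  simp only [Finset.mem_filter, Finset.mem_univ, true_and, Function.update_self]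
  positivity

/-- Lowering `p i` to zero can only raise the index. If `p i` already lies below the raised
threshold, the rejections at that threshold are the same for `p`, so nothing was gained. -/
lemma bhCount_eq_of_le {i : Fin m} (h0 : 0 ≤ p i)
    (h : p i ≤ α * bhCount α (Function.update p i 0) / m) :
    bhCount α p = bhCount α (Function.update p i 0) := by
  refine le_antisymm (bhCount_anti fun j => ?_) ?_
  · by_cases hj : j = i
    · subst hj; simpa using h0
    · simp [hj]
  · refine le_bhCount (bhCount_le _ _) ((bhCount_le_card α _).trans (Finset.card_le_card ?_))
    intro j hj
    refine Finset.mem_filter.2 ⟨Finset.mem_univ _, ?_⟩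
    by_cases hji : j = i
    · subst hji; exact h
    · simpa [hji] using mem_BH.1 hj

/-- The leave-one-out form of the step-up procedure: `p i` is compared with a threshold that depends
on the other p-values only. -/
lemma mem_BH_iff_update (hα : 0 ≤ α) {i : Fin m} (h0 : 0 ≤ p i) :
    i ∈ BH α p ↔ p i ≤ α * bhCount α (Function.update p i 0) / m := by
  refine ⟨fun h => (mem_BH.1 h).trans ?_, fun h => mem_BH.2 ?_⟩
  · gcongr
    refine bhCount_anti fun j => ?_
    by_cases hj : j = i
    · subst hj; simpa using h0
    · simp [hj]
  · rw [bhCount_eq_of_le h0 h]; exact h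

/-- The contribution of the index `i` to the false discovery proportion, if it is a true null. -/
def rejWeight (α : ℝ) (i : Fin m) (p : Fin m → ℝ) : ℝ :=
  if i ∈ BH α p then ((bhCount α p : ℝ))⁻¹ else 0

lemma rejWeight_nonneg (α : ℝ) (i : Fin m) (p : Fin m → ℝ) : 0 ≤ rejWeight α i p := by
  unfold rejWeight; split_ifs <;> positivity

lemma rejWeight_le_one (hα : 0 ≤ α) (i : Fin m) (p : Fin m → ℝ) : rejWeight α i p ≤ 1 := by
  unfold rejWeight; split_ifs with h
  · refine inv_le_one_of_one_le₀ ?_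
    rw [← card_BH hα]
    exact_mod_cast Finset.card_pos.2 ⟨i, h⟩
  · exact zero_le_one

lemma rejWeight_eq_update (hα : 0 ≤ α) {i : Fin m} (h0 : 0 ≤ p i) :
    rejWeight α i p = if p i ≤ α * bhCount α (Function.update p i 0) / m
      then ((bhCount α (Function.update p i 0) : ℝ))⁻¹ else 0 := by
  unfold rejWeight
  by_cases h : p i ≤ α * bhCount α (Function.update p i 0) / m
  · rw [if_pos h, if_pos ((mem_BH_iff_update hα h0).2 h), bhCount_eq_of_le h0 h]
  · rw [if_neg h, if_neg (mt (mem_BH_iff_update hα h0).1 h)]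

lemma FDP_BH (hα : 0 ≤ α) (P : Model m) (p : Fin m → ℝ) :
    FDP P (BH α p) = ∑ i ∈ P.H0, rejWeight α i p := by
  unfold FDP rejWeight
  rw [← Finset.sum_filter, Finset.sum_const, Finset.filter_mem_eq_inter, nsmul_eq_mul, card_BH hα,
    div_eq_mul_inv]
  -- With no rejection the inverse takes its default value `0`, which is harmless because the
  -- numerator vanishes.
  rcases Nat.eq_zero_or_pos (bhCount α p) with h | h
  · have : BH α p = ∅ := by rw [← Finset.card_eq_zero, card_BH hα, h]
    simp [this]
  · rw [max_eq_right (by exact_mod_cast h)]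

end StepUp

/-! ### Measurability of the procedures. -/

section Measurability

variable {m : ℕ} {α : ℝ}

lemma measurable_card_filter {ι Ω : Type*} [MeasurableSpace Ω] [Fintype ι]
    {s : ι → Set Ω} (hs : ∀ i, MeasurableSet (s i)) :
    Measurable fun ω => (Finset.univ.filter (fun i => ω ∈ s i)).card := by
  simp_rw [Finset.card_filter]
  exact Finset.measurable_sum _ fun i _ =>
    Measurable.ite (hs i) measurable_const measurable_const

lemma measurable_bhCount : Measurable fun p : Fin m → ℝ => bhCount α p := by
  refine measurable_findGreatest fun k hk => ?_
  rcases Nat.eq_zero_or_pos k with h0 | h0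
  · subst h0
    simp [orderStat]
  · simp_rw [orderStat_le_iff _ h0 hk]
    exact measurableSet_le measurable_const (measurable_card_filter
      (s := fun i => {p : Fin m → ℝ | p i ≤ α * k / m})
      fun i => measurableSet_le (measurable_pi_apply i) measurable_const)

lemma measurableSet_mem_BH (i : Fin m) : MeasurableSet {p : Fin m → ℝ | i ∈ BH α p} := by
  simp_rw [mem_BH]
  refine measurableSet_le (measurable_pi_apply i) ?_
  have : Measurable fun p : Fin m → ℝ => (bhCount α p : ℝ) :=
    measurable_from_nat.comp measurable_bhCount
  fun_prop

lemma measurableSet_BH_eq (S : Finset (Fin m)) : MeasurableSet {p : Fin m → ℝ | BH α p = S} := by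
  have : {p : Fin m → ℝ | BH α p = S} = ⋂ i, {p | i ∈ BH α p ↔ i ∈ S} := by
    ext p; simp [Finset.ext_iff]
  rw [this]
  refine MeasurableSet.iInter fun i => ?_
  by_cases h : i ∈ S
  · simpa [h] using measurableSet_mem_BH i
  · simp only [h, iff_false]
    exact (measurableSet_mem_BH i).compl

lemma measurable_rejWeight (i : Fin m) : Measurable (rejWeight α i) := by
  refine Measurable.ite (measurableSet_mem_BH i) ?_ measurable_const
  exact (measurable_from_nat.comp measurable_bhCount).inv

lemma Model.measurable_F0 (P : Model m) : Measurable P.F0 := by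
  refine Antitone.measurable fun s t hst => ?_
  exact measureReal_mono (Ici_subset_Ici.2 hst)

lemma measurable_empPValue {n : ℕ} : Measurable fun z : Sample n m => empPValue z := by
  refine measurable_pi_lambda _ fun i => ?_
  have : Measurable fun z : Sample n m =>
      (Finset.univ.filter (fun j : Fin n => z.2 i ≤ z.1 j)).card :=
    measurable_card_filter (s := fun j => {z : Sample n m | z.2 i ≤ z.1 j}) fun j =>
      measurableSet_le (by fun_prop) (by fun_prop)
  have h2 : Measurable fun k : ℕ => (1 + (k : ℝ)) / ((n : ℝ) + 1) := measurable_from_nat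
  exact h2.comp this

lemma isProcedure_semiBH (α : ℝ) : IsProcedure (semiBH α) := fun _ _ S =>
  measurable_empPValue (measurableSet_BH_eq S)

end Measurability

/-! ### Uniformity of the null p-values. -/

section UpperTail

variable {m : ℕ} (P : Model m)

lemma Model.F0_nonneg (t : ℝ) : 0 ≤ P.F0 t := measureReal_nonneg

lemma Model.antitone_F0 : Antitone P.F0 := fun _ _ hst =>
  measureReal_mono (Ici_subset_Ici.2 hst)

lemma Model.F0_eq_one_sub_cdf (t : ℝ) : P.F0 t = 1 - ProbabilityTheory.cdf P.null t := by
  rw [ProbabilityTheory.cdf_eq_real, Model.F0, measureReal_congr (Ioi_ae_eq_Ici (a := t)).symm,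
    ← compl_Iic, probReal_compl_eq_one_sub measurableSet_Iic]

lemma Model.continuous_F0 : Continuous P.F0 := by
  have h1 : P.F0 = fun t => 1 - ProbabilityTheory.cdf P.null t := funext P.F0_eq_one_sub_cdf
  rw [h1]
  refine continuous_const.sub (continuous_iff_continuousAt.2 fun x => ?_)
  -- The jump of the distribution function at `x` is the mass of `{x}`, which is zero; right
  -- continuity is automatic.
  have h2 := (ProbabilityTheory.cdf P.null).measure_singleton x
  rw [ProbabilityTheory.measure_cdf, measure_singleton, eq_comm, ENNReal.ofReal_eq_zero,
    sub_nonpos] at h2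
  have hm := (ProbabilityTheory.cdf P.null).mono
  refine continuousAt_iff_continuous_left'_right'.2 ⟨?_, ?_⟩
  · rw [hm.continuousWithinAt_Iio_iff_leftLim_eq]
    exact le_antisymm (hm.leftLim_le le_rfl) h2
  · exact ((ProbabilityTheory.cdf P.null).right_continuous x).mono Ioi_subset_Ici_self

lemma Model.exists_F0_eq {t : ℝ} (ht : t ∈ Ioo (0 : ℝ) 1) : ∃ x, P.F0 x = t := by
  have hb : Filter.Tendsto P.F0 Filter.atBot (nhds (1 - 0)) := by
    simp_rw [funext P.F0_eq_one_sub_cdf]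
    exact (ProbabilityTheory.tendsto_cdf_atBot P.null).const_sub 1
  have ht' : Filter.Tendsto P.F0 Filter.atTop (nhds (1 - 1)) := by
    simp_rw [funext P.F0_eq_one_sub_cdf]
    exact (ProbabilityTheory.tendsto_cdf_atTop P.null).const_sub 1
  rw [sub_zero] at hb
  rw [sub_self] at ht'
  obtain ⟨a, ha⟩ := (hb.eventually (lt_mem_nhds ht.2)).exists
  obtain ⟨b, hb'⟩ := (ht'.eventually (gt_mem_nhds ht.1)).exists
  exact mem_range_of_exists_le_of_exists_ge P.continuous_F0 ⟨b, hb'.le⟩ ⟨a, ha.le⟩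

/-- The null p-values are super-uniform. -/
lemma Model.null_F0_le_le {t : ℝ} (ht : 0 ≤ t) : P.null.real {x | P.F0 x ≤ t} ≤ t := by
  -- Passing to `s > t` gives a strict inequality `F0 y < F0 x`, which forces `x ≤ y` although `F0`
  -- may have flat pieces.
  refine le_of_forall_gt_imp_ge_of_dense fun s hs => ?_
  rcases le_or_gt 1 s with h1 | h1
  · exact measureReal_le_one.trans h1
  · obtain ⟨x, hx⟩ := P.exists_F0_eq (t := s) ⟨ht.trans_lt hs, h1⟩
    calc P.null.real {y | P.F0 y ≤ t} ≤ P.null.real (Ici x) := by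
          refine measureReal_mono fun y hy => ?_
          by_contra hyx
          have := P.antitone_F0 (not_le.1 hyx).le
          simp only [mem_ofPred_eq] at hy
          linarith
      _ = s := hx

/-- The null p-values are uniformly distributed. -/
lemma Model.null_F0_le {t : ℝ} (ht : t ∈ Ioo (0 : ℝ) 1) : P.null.real {x | P.F0 x ≤ t} = t := by
  refine le_antisymm (P.null_F0_le_le ht.1.le) ?_
  obtain ⟨x, hx⟩ := P.exists_F0_eq ht
  calc t = P.null.real (Ici x) := hx.symm
    _ ≤ _ := measureReal_mono fun y hy => (P.antitone_F0 hy).trans hx.le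

end UpperTail

/-! ### Invariances of product measures. -/

section Invariance

variable {ι : Type*} [Fintype ι] {μ : ι → Measure ℝ} [∀ i, IsProbabilityMeasure (μ i)]

/-- Drawing one coordinate anew leaves a product measure invariant. -/
lemma measurePreserving_update [DecidableEq ι] (i : ι) :
    MeasurePreserving (fun w : (ι → ℝ) × ℝ => Function.update w.1 i w.2)
      ((Measure.pi μ).prod (μ i)) (Measure.pi μ) := by
  have hm : Measurable fun w : (ι → ℝ) × ℝ => Function.update w.1 i w.2 := by
    refine measurable_pi_lambda _ fun j => ?_
    by_cases hj : j = i
    · subst hj; simpa using measurable_snd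
    · simp only [hj, ne_eq, not_false_eq_true, Function.update_of_ne]
      fun_prop
  refine ⟨hm, (Measure.pi_eq fun s hs => ?_).symm⟩
  rw [Measure.map_apply hm (MeasurableSet.univ_pi hs)]
  have : (fun w : (ι → ℝ) × ℝ => Function.update w.1 i w.2) ⁻¹' univ.pi s =
      (univ.pi (Function.update s i univ)) ×ˢ s i := by
    ext w
    simp only [mem_preimage, mem_pi, mem_univ, true_implies, mem_prod]
    constructor
    · refine fun h => ⟨fun j => ?_, by simpa using h i⟩
      by_cases hj : j = i
      · subst hj; simp
      · simpa [hj] using h j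
    · rintro ⟨h, h'⟩ j
      by_cases hj : j = i
      · subst hj; simpa using h'
      · simpa [hj] using h j
  rw [this, Measure.prod_prod, Measure.pi_pi, ← Finset.prod_erase_mul _ _ (Finset.mem_univ i),
    ← Finset.prod_erase_mul (a := i) _ (fun i => μ i (s i)) (Finset.mem_univ i)]
  simp only [Function.update_self, measure_univ, mul_one]
  congr 1
  refine Finset.prod_congr rfl fun j hj => ?_
  rw [Function.update_of_ne (Finset.ne_of_mem_erase hj)]

lemma measurePreserving_comp_perm (σ : Equiv.Perm ι) (h : ∀ i, μ (σ i) = μ i) :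
    MeasurePreserving (fun ω : ι → ℝ => ω ∘ σ) (Measure.pi μ) (Measure.pi μ) := by
  have hm : Measurable fun ω : ι → ℝ => ω ∘ σ :=
    measurable_pi_lambda _ fun j => measurable_pi_apply (σ j)
  refine ⟨hm, (Measure.pi_eq fun s hs => ?_).symm⟩
  rw [Measure.map_apply hm (MeasurableSet.univ_pi hs)]
  have : (fun ω : ι → ℝ => ω ∘ σ) ⁻¹' univ.pi s = univ.pi (s ∘ σ.symm) := by
    ext ω
    simp only [mem_preimage, mem_pi, mem_univ, true_implies, Function.comp_apply]
    exact ⟨fun h i => by simpa using h (σ.symm i), fun h i => by simpa using h (σ i)⟩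
  rw [this, Measure.pi_pi, ← Equiv.prod_comp σ]
  simp [h]

end Invariance

/-! ### Exact false discovery rate of the oracle. -/

section OracleFDR

variable {n m : ℕ} {α : ℝ} (P : Model m)

instance : IsProbabilityMeasure (P.law n) := by unfold Model.law; infer_instance

lemma FDR_BH (hα : 0 ≤ α) {p : Sample n m → Fin m → ℝ} (hp : Measurable p) :
    FDR P (fun z => BH α (p z)) = ∑ i ∈ P.H0, ∫ z, rejWeight α i (p z) ∂(P.law n) := by
  unfold FDR
  simp_rw [FDP_BH hα]
  refine integral_finsetSum _ fun i _ => ?_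
  refine Integrable.of_bound ((measurable_rejWeight i).comp hp).aestronglyMeasurable 1 ?_
  refine Filter.Eventually.of_forall fun z => ?_
  rw [Real.norm_eq_abs, abs_of_nonneg (rejWeight_nonneg _ _ _)]
  exact rejWeight_le_one hα _ _

lemma integral_rejWeight_oracle (hα : α ∈ Ioo (0 : ℝ) 1) {i : Fin m} (hi : i ∈ P.H0) :
    ∫ z, rejWeight α i (fun j => P.F0 (z.2 j)) ∂(P.law n) = α / m := by
  have hm : Measurable fun x : Fin m → ℝ => rejWeight α i (fun j => P.F0 (x j)) :=
    (measurable_rejWeight i).comp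
      (measurable_pi_lambda _ fun j => P.measurable_F0.comp (measurable_pi_apply j))
  have hPi : P.test i = P.null := (Finset.mem_filter.1 hi).2
  have hmp := measurePreserving_update (μ := P.test) i
  have h0 : ∫ z, rejWeight α i (fun j => P.F0 (z.2 j)) ∂(P.law n) =
      ∫ x, rejWeight α i (fun j => P.F0 (x j)) ∂(Measure.pi P.test) := by
    unfold Model.law
    rw [integral_fun_snd (fun x : Fin m → ℝ => rejWeight α i (fun j => P.F0 (x j)))]
    simp
  have hbd : ∀ x : Fin m → ℝ, ‖rejWeight α i (fun j => P.F0 (x j))‖ ≤ 1 := fun x => by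
    rw [Real.norm_eq_abs, abs_of_nonneg (rejWeight_nonneg _ _ _)]
    exact rejWeight_le_one hα.1.le _ _
  rw [h0, ← hmp.map_eq, integral_map hmp.measurable.aemeasurable
    (by rw [hmp.map_eq]; exact hm.aestronglyMeasurable), integral_prod]
  -- `X_i` is redrawn as an independent `u`. The leave-one-out index `K` does not depend on `u`, so
  -- the inner integral is `(αK/m) · K⁻¹`.
  · have hin : ∀ x : Fin m → ℝ,
        ∫ u, rejWeight α i (fun j => P.F0 (Function.update x i u j)) ∂(P.test i) = α / m := by
      intro x
      set K := bhCount α (Function.update (fun j => P.F0 (x j)) i 0) with hK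
      have hK1 : 1 ≤ K := one_le_bhCount_update hα.1.le _ i
      have hKm : K ≤ m := bhCount_le _ _
      have hm0 : (0 : ℝ) < m := by exact_mod_cast hK1.trans hKm
      have hK0 : (0 : ℝ) < K := by exact_mod_cast hK1
      have hKm' : (K : ℝ) ≤ m := by exact_mod_cast hKm
      have hup : ∀ u, Function.update (fun j => P.F0 (Function.update x i u j)) i 0 =
          Function.update (fun j => P.F0 (x j)) i 0 := by
        intro u; ext j
        by_cases hj : j = i
        · subst hj; simp
        · simp [hj]
      have hrw : ∀ u, rejWeight α i (fun j => P.F0 (Function.update x i u j)) =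
          {u | P.F0 u ≤ α * K / m}.indicator (fun _ => (K : ℝ)⁻¹) u := by
        intro u
        rw [rejWeight_eq_update hα.1.le (P.F0_nonneg _), hup, Function.update_self, ← hK]
        rfl
      simp_rw [hrw]
      rw [integral_indicator_const _ (measurableSet_le P.measurable_F0 measurable_const), hPi,
        P.null_F0_le, smul_eq_mul]
      · field_simp
      · refine ⟨by have := hα.1; positivity, ?_⟩
        rw [div_lt_one hm0]
        nlinarith [hα.1, hα.2]
    calc _ = ∫ _, α / m ∂(Measure.pi P.test) :=
          integral_congr_ae (Filter.Eventually.of_forall hin)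
      _ = α / m := by simp
  · refine Integrable.of_bound (hm.comp hmp.measurable).aestronglyMeasurable 1
      (Filter.Eventually.of_forall fun w => hbd _)

/-- The oracle BH procedure has false discovery rate exactly `α m₀ / m`. -/
lemma FDR_oracleBH (hα : α ∈ Ioo (0 : ℝ) 1) :
    FDR P (oracleBH (n := n) α P) = P.H0.card * (α / m) := by
  have hp : Measurable fun z : Sample n m => fun i => P.F0 (z.2 i) :=
    measurable_pi_lambda _ fun i => P.measurable_F0.comp (by fun_prop)
  refine (FDR_BH P hα.1.le hp).trans ?_
  rw [Finset.sum_congr rfl fun i hi => integral_rejWeight_oracle P hα hi]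
  simp

end OracleFDR

/-! ### FDR control of the semi-supervised procedure by exchangeability. -/

section Exchange

variable {n m : ℕ} {α : ℝ}

/-- Exchange of the test observation `X_i` with a training observation, or with itself. -/
def exchange (i : Fin m) : Option (Fin n) → Sample n m → Sample n m
  | none => id
  | some j => fun z => (Function.update z.1 j (z.2 i), Function.update z.2 i (z.1 j))

/-- The training sample augmented by the test observation `X_i`. -/
def augmented (i : Fin m) (z : Sample n m) : Option (Fin n) → ℝ
  | none => z.2 i
  | some j => z.1 j

/-- Viewed as one product measure over `Fin n ⊕ Fin m`, the law is unchanged by swapping two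
coordinates that both have marginal `P_0`. -/
lemma measurePreserving_exchange (P : Model m) {i : Fin m} (hi : i ∈ P.H0) (a : Option (Fin n)) :
    MeasurePreserving (exchange i a) (P.law n) (P.law n) := by
  cases a with
  | none => exact MeasurePreserving.id _
  | some j =>
    have hPi : P.test i = P.null := (Finset.mem_filter.1 hi).2
    let μ : Fin n ⊕ Fin m → Measure ℝ := Sum.elim (fun _ => P.null) P.test
    have hμ : ∀ a, IsProbabilityMeasure (μ a) := by
      rintro (a | a)
      · exact P.null_prob
      · exact P.test_prob a
    have he := measurePreserving_sumPiEquivProdPi (X := fun _ : Fin n ⊕ Fin m => ℝ) μ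
    have hσ := measurePreserving_comp_perm (μ := μ) (Equiv.swap (Sum.inl j) (Sum.inr i)) (by
      intro a
      rcases eq_or_ne a (Sum.inl j) with rfl | h1
      · simp [μ, hPi]
      rcases eq_or_ne a (Sum.inr i) with rfl | h2
      · simp [μ, hPi]
      · rw [Equiv.swap_apply_of_ne_of_ne h1 h2])
    have h := (he.comp hσ).comp (he.symm _)
    refine (congrArg (fun f => MeasurePreserving f (P.law n) (P.law n)) ?_).mpr h
    ext z k
    · by_cases hk : k = j
      · subst hk; simp [exchange, MeasurableEquiv.sumPiEquivProdPi, Equiv.sumPiEquivProdPi]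
      · have : Equiv.swap (Sum.inl j) (Sum.inr i) (Sum.inl k) = (Sum.inl k : Fin n ⊕ Fin m) :=
          Equiv.swap_apply_of_ne_of_ne (by simpa using hk) (by simp)
        simp [exchange, MeasurableEquiv.sumPiEquivProdPi, Equiv.sumPiEquivProdPi, hk, this]
    · by_cases hk : k = i
      · subst hk; simp [exchange, MeasurableEquiv.sumPiEquivProdPi, Equiv.sumPiEquivProdPi]
      · have : Equiv.swap (Sum.inl j) (Sum.inr i) (Sum.inr k) = (Sum.inr k : Fin n ⊕ Fin m) :=
          Equiv.swap_apply_of_ne_of_ne (by simp) (by simpa using hk)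
        simp [exchange, MeasurableEquiv.sumPiEquivProdPi, Equiv.sumPiEquivProdPi, hk, this]

lemma augmented_exchange (i : Fin m) (a : Option (Fin n)) (z : Sample n m) :
    augmented i (exchange i a z) = augmented i z ∘ Equiv.swap none a := by
  ext b
  cases a with
  | none => simp [exchange]
  | some j =>
    cases b with
    | none => simp [exchange, augmented]
    | some k =>
      by_cases hk : k = j
      · subst hk; simp [exchange, augmented]
      · have : Equiv.swap none (some j) (some k) = some k :=
          Equiv.swap_apply_of_ne_of_ne (by simp) (by simpa using hk)
        simp [exchange, augmented, hk, this]

lemma exchange_snd_self (i : Fin m) (a : Option (Fin n)) (z : Sample n m) :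
    (exchange i a z).2 i = augmented i z a := by
  cases a <;> simp [exchange, augmented]

lemma exchange_snd_of_ne {i k : Fin m} (hk : k ≠ i) (a : Option (Fin n)) (z : Sample n m) :
    (exchange i a z).2 k = z.2 k := by
  cases a <;> simp [exchange, hk]

lemma card_le_augmented (i : Fin m) (z : Sample n m) (t : ℝ) :
    (Finset.univ.filter (fun b => t ≤ augmented i z b)).card =
      (if t ≤ z.2 i then 1 else 0) + (Finset.univ.filter (fun j : Fin n => t ≤ z.1 j)).card := by
  simp only [Finset.card_filter, Fintype.sum_option]
  rfl

/-- The number of exceedances of `t` in the exchanged training sample. -/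
lemma card_le_exchange (i : Fin m) (a : Option (Fin n)) (z : Sample n m) (t : ℝ) :
    (if t ≤ augmented i z a then 1 else 0) +
      (Finset.univ.filter (fun j : Fin n => t ≤ (exchange i a z).1 j)).card =
      (Finset.univ.filter (fun b => t ≤ augmented i z b)).card := by
  rw [← exchange_snd_self, ← card_le_augmented, augmented_exchange]
  exact Finset.card_bijective (Equiv.swap none a) (Equiv.swap none a).bijective (by simp)

lemma empPValue_exchange_self (i : Fin m) (a : Option (Fin n)) (z : Sample n m) :
    empPValue (exchange i a z) i =
      ((Finset.univ.filter (fun b => augmented i z a ≤ augmented i z b)).card : ℝ) / (n + 1) := by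
  have h := card_le_exchange i a z (augmented i z a)
  rw [if_pos le_rfl] at h
  rw [empPValue, exchange_snd_self, ← h]
  push_cast
  rfl

/-- Moving a larger value into the test slot improves the rank of `X_i` and leaves a smaller
training sample, so every empirical p-value goes down, not just the `i`-th. -/
lemma empPValue_exchange_mono (i : Fin m) {a b : Option (Fin n)} (z : Sample n m)
    (h : augmented i z b ≤ augmented i z a) (k : Fin m) :
    empPValue (exchange i a z) k ≤ empPValue (exchange i b z) k := by
  by_cases hk : k = i
  · subst hk
    rw [empPValue_exchange_self, empPValue_exchange_self]
    gcongr
  · unfold empPValue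
    rw [exchange_snd_of_ne hk, exchange_snd_of_ne hk]
    have ha := card_le_exchange i a z (z.2 k)
    have hb := card_le_exchange i b z (z.2 k)
    have : (Finset.univ.filter (fun j : Fin n => z.2 k ≤ (exchange i a z).1 j)).card ≤
        (Finset.univ.filter (fun j : Fin n => z.2 k ≤ (exchange i b z).1 j)).card := by
      by_cases h2 : z.2 k ≤ augmented i z b
      · rw [if_pos (h2.trans h)] at ha
        rw [if_pos h2] at hb
        omega
      · rw [if_neg h2] at hb
        split_ifs at ha <;> omega
    gcongr

/-- Given the augmented training sample and the other test observations, the rank of a null test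
observation is uniform and the step-up index is monotone in that rank. -/
lemma sum_rejWeight_exchange_le (hα : 0 ≤ α) (i : Fin m) (z : Sample n m) :
    ∑ a, rejWeight α i (empPValue (exchange i a z)) ≤ (n + 1) * (α / m) := by
  unfold rejWeight
  rw [← Finset.sum_filter]
  set J := Finset.univ.filter fun a => i ∈ BH α (empPValue (exchange i a z)) with hJ
  rcases J.eq_empty_or_nonempty with h | h
  · rw [h, Finset.sum_empty]; positivity
  -- The least favourable rejecting exchange `b` has the smallest index `K` in `J`. All of `J` ranks
  -- at or above `b`, so `|J|` is at most `n + 1` times the empirical p-value at `b`, hence at most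
  -- `(n + 1) αK/m`. The factors `K` cancel.
  obtain ⟨b, hb, hmin⟩ := J.exists_min_image (augmented i z) h
  have hbB : i ∈ BH α (empPValue (exchange i b z)) := (Finset.mem_filter.1 hb).2
  set K := bhCount α (empPValue (exchange i b z)) with hK
  have hK1 : (0 : ℝ) < K := by
    rw [hK, ← card_BH hα]
    exact_mod_cast Finset.card_pos.2 ⟨i, hbB⟩
  have hJK : (J.card : ℝ) ≤ (n + 1) * (α * K / m) := by
    have h1 := mem_BH.1 hbB
    rw [empPValue_exchange_self, div_le_iff₀ (by positivity)] at h1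
    refine le_trans ?_ (h1.trans_eq (mul_comm _ _))
    exact_mod_cast Finset.card_le_card fun a ha =>
      Finset.mem_filter.2 ⟨Finset.mem_univ _, hmin a ha⟩
  calc ∑ a ∈ J, ((bhCount α (empPValue (exchange i a z)) : ℝ))⁻¹ ≤ ∑ a ∈ J, (K : ℝ)⁻¹ := by
        refine Finset.sum_le_sum fun a ha => inv_anti₀ hK1 ?_
        exact_mod_cast bhCount_anti (empPValue_exchange_mono i z (hmin a ha))
    _ = J.card * (K : ℝ)⁻¹ := by simp
    _ ≤ (n + 1) * (α * K / m) * (K : ℝ)⁻¹ := by gcongr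
    _ = (n + 1) * (α / m) := by field_simp

/-- All `n + 1` exchanges have the same integral, so the pointwise bound on their sum is divided by
`n + 1`. -/
lemma integral_rejWeight_semi_le (hα : 0 ≤ α) (P : Model m) {i : Fin m} (hi : i ∈ P.H0) :
    ∫ z, rejWeight α i (empPValue z) ∂(P.law n) ≤ α / m := by
  have hm : Measurable fun z : Sample n m => rejWeight α i (empPValue z) :=
    (measurable_rejWeight i).comp measurable_empPValue
  have hint : ∀ a : Option (Fin n), Integrable
      (fun z : Sample n m => rejWeight α i (empPValue (exchange i a z))) (P.law n) := by
    intro a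
    refine Integrable.of_bound
      (hm.comp (measurePreserving_exchange P hi a).measurable).aestronglyMeasurable 1 ?_
    refine Filter.Eventually.of_forall fun z => ?_
    rw [Real.norm_eq_abs, abs_of_nonneg (rejWeight_nonneg _ _ _)]
    exact rejWeight_le_one hα _ _
  have heq : ∀ a : Option (Fin n),
      ∫ z, rejWeight α i (empPValue (exchange i a z)) ∂(P.law n) =
        ∫ z, rejWeight α i (empPValue z) ∂(P.law n) := by
    intro a
    have hmp := measurePreserving_exchange P hi a
    conv_rhs => rw [← hmp.map_eq]
    rw [integral_map hmp.measurable.aemeasurable hm.aestronglyMeasurable]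
  have hsum : ∫ z, ∑ a, rejWeight α i (empPValue (exchange i a z)) ∂(P.law n) ≤
      (n + 1) * (α / m) := by
    calc _ ≤ ∫ _, ((n : ℝ) + 1) * (α / m) ∂(P.law n) :=
          integral_mono (integrable_finsetSum _ fun a _ => hint a) (integrable_const _)
            (sum_rejWeight_exchange_le hα i)
      _ = _ := by simp
  rw [integral_finsetSum _ fun a _ => hint a, Finset.sum_congr rfl fun a _ => heq a,
    Finset.sum_const, Finset.card_univ, Fintype.card_option, Fintype.card_fin, nsmul_eq_mul] at hsum
  push_cast at hsum
  exact le_of_mul_le_mul_left hsum (by positivity)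

/-- The semi-supervised BH procedure controls the false discovery rate at level `α m₀ / m`. -/
lemma FDR_semiBH_le (hα : 0 ≤ α) (P : Model m) :
    FDR P (semiBH α n m) ≤ P.H0.card * (α / m) := by
  refine (FDR_BH P hα measurable_empPValue).trans_le ?_
  refine (Finset.sum_le_sum fun i hi => integral_rejWeight_semi_le hα P hi).trans_eq ?_
  simp

end Exchange

/-! ### A Chernoff bound for binomial counts. -/

section Chernoff

lemma integral_exp_indicator (ν : Measure ℝ) [IsProbabilityMeasure ν] {A : Set ℝ}
    (hA : MeasurableSet A) (θ : ℝ) :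
    ∫ y, Real.exp (if y ∈ A then θ else 0) ∂ν = 1 + ν.real A * (Real.exp θ - 1) := by
  have : ∀ y, Real.exp (if y ∈ A then θ else 0) =
      1 + A.indicator (fun _ => Real.exp θ - 1) y := by
    intro y
    by_cases hy : y ∈ A <;> simp [hy]
  simp_rw [this]
  rw [integral_add (integrable_const _) ((integrable_const _).indicator hA),
    integral_indicator_const _ hA]
  simp

/-- A Chernoff bound for the number of hits of a set by an i.i.d. sample. -/
lemma chernoff_card (ν : Measure ℝ) [IsProbabilityMeasure ν] {A : Set ℝ} (hA : MeasurableSet A)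
    {q : ℝ} (hq : ν.real A ≤ q) {θ : ℝ} (hθ : θ ∈ Icc (0 : ℝ) 1) (n : ℕ) (a : ℝ) :
    (Measure.pi fun _ : Fin n => ν).real
      {y | a ≤ ((Finset.univ.filter fun j => y j ∈ A).card : ℝ)} ≤
      Real.exp (-θ * a + n * q * (θ + θ ^ 2)) := by
  set N : (Fin n → ℝ) → ℝ := fun y => ((Finset.univ.filter fun j => y j ∈ A).card : ℝ) with hN
  have hNm : Measurable N := by
    have h1 : Measurable fun y : Fin n → ℝ => (Finset.univ.filter fun j => y j ∈ A).card :=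
      measurable_card_filter (s := fun j => {y : Fin n → ℝ | y j ∈ A})
        fun j => (measurable_pi_apply j) hA
    have h2 : Measurable fun k : ℕ => (k : ℝ) := measurable_from_nat
    exact h2.comp h1
  have hNle : ∀ y, N y ≤ n := fun y => by
    have := Finset.card_le_univ (Finset.univ.filter fun j => y j ∈ A)
    rw [Fintype.card_fin] at this
    exact Nat.cast_le.2 this
  have hint : Integrable (fun y => Real.exp (θ * N y)) (Measure.pi fun _ : Fin n => ν) := by
    refine Integrable.of_bound (hNm.const_mul θ).exp.aestronglyMeasurable (Real.exp (θ * n)) ?_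
    refine Filter.Eventually.of_forall fun y => ?_
    rw [Real.norm_eq_abs, abs_of_pos (Real.exp_pos _)]
    exact Real.exp_le_exp.2 (mul_le_mul_of_nonneg_left (hNle y) hθ.1)
  refine (ProbabilityTheory.measure_ge_le_exp_mul_mgf a hθ.1 hint).trans ?_
  rw [Real.exp_add]
  refine mul_le_mul_of_nonneg_left ?_ (Real.exp_pos _).le
  have hmgf : ProbabilityTheory.mgf N (Measure.pi fun _ : Fin n => ν) θ =
      (1 + ν.real A * (Real.exp θ - 1)) ^ n := by
    have hprod : ∀ y, Real.exp (θ * N y) = ∏ j, Real.exp (if y j ∈ A then θ else 0) := by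
      intro y
      rw [← Real.exp_sum, hN, ← Finset.sum_filter, Finset.sum_const, nsmul_eq_mul, mul_comm]
    unfold ProbabilityTheory.mgf
    simp_rw [hprod]
    rw [integral_fintype_prod_eq_prod (μ := fun _ : Fin n => ν)
      (fun _ y => Real.exp (if y ∈ A then θ else 0))]
    simp [integral_exp_indicator ν hA]
  have he : Real.exp θ - 1 ≤ θ + θ ^ 2 := by
    have := Real.abs_exp_sub_one_sub_id_le (x := θ) (by rw [abs_of_nonneg hθ.1]; exact hθ.2)
    have := (abs_le.1 this).2
    linarith
  have he0 : 0 ≤ Real.exp θ - 1 := by linarith [Real.add_one_le_exp θ, hθ.1]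
  have hA0 : 0 ≤ ν.real A := measureReal_nonneg
  rw [hmgf]
  calc (1 + ν.real A * (Real.exp θ - 1)) ^ n
      ≤ (Real.exp (q * (θ + θ ^ 2))) ^ n := by
        refine pow_le_pow_left₀ (by positivity) ?_ n
        refine le_trans ?_ (Real.add_one_le_exp _)
        rw [add_comm]
        gcongr
        exact hA0.trans hq
    _ = Real.exp (n * q * (θ + θ ^ 2)) := by
        rw [← Real.exp_nat_mul, mul_assoc]

end Chernoff

/-! ### Power of the semi-supervised procedure. -/

section Power

variable {n m : ℕ} {α η : ℝ}

/-- The event that the training sample has too many points among the null p-values below the `k`-th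
threshold of the relaxed oracle. -/
def overshoot (α η : ℝ) (P : Model m) (n k : ℕ) : Set (Fin n → ℝ) :=
  {y | ((n : ℝ) + 1) * (α * k / m) - 1 <
    ((Finset.univ.filter fun j => P.F0 (y j) ≤ α * (1 - η) * k / m).card : ℝ)}

lemma TDP_mono (P : Model m) {S T : Finset (Fin m)} (h : S ⊆ T) : TDP P S ≤ TDP P T := by
  unfold TDP
  gcongr

/-- A training point beyond `X_i` has a null p-value no larger than that of `X_i`, so the numerator
of the empirical p-value is controlled by the count in `overshoot`. The `- 1` there absorbs the `1
+` of the empirical p-value. -/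
lemma oracleBH_subset_semiBH (hα : 0 ≤ α) (hη : η ≤ 1) (P : Model m) (z : Sample n m)
    (hz : ∀ k : ℕ, 1 ≤ k → k ≤ m → z.1 ∉ overshoot α η P n k) :
    oracleBH (α * (1 - η)) P z ⊆ semiBH α n m z := by
  refine BH_subset_BH (mul_nonneg hα (by linarith)) hα fun k hk hkm i hi => ?_
  have h := hz k hk hkm
  simp only [overshoot, mem_ofPred_eq, not_lt] at h
  rw [empPValue, div_le_iff₀ (by positivity)]
  have hle : ((Finset.univ.filter fun j : Fin n => z.2 i ≤ z.1 j).card : ℝ) ≤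
      ((Finset.univ.filter fun j => P.F0 (z.1 j) ≤ α * (1 - η) * k / m).card : ℝ) := by
    norm_cast
    refine Finset.card_le_card fun j hj => ?_
    exact Finset.mem_filter.2 ⟨Finset.mem_univ _,
      (P.antitone_F0 (Finset.mem_filter.1 hj).2).trans hi⟩
  linarith

lemma measure_overshoot_le (hα : α ∈ Ioo (0 : ℝ) 1) (hη : η ∈ Ioo (0 : ℝ) 1) {γ : ℝ}
    (hγ : gammaUpper α η ≤ γ) (hm : 1 ≤ m) (hnm : (m : ℝ) * γ ≤ n) (P : Model m) {k : ℕ}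
    (hk : 1 ≤ k) :
    (Measure.pi fun _ : Fin n => P.null).real (overshoot α η P n k) ≤
      ((1 / 2 : ℝ) ^ (3 * γ / gammaUpper α η)) ^ k := by
  have hm0 : (0 : ℝ) < m := by exact_mod_cast hm
  have hk1 : (1 : ℝ) ≤ k := by exact_mod_cast hk
  have hlog := Real.log_two_gt_d9
  have hlog0 : 0 < Real.log 2 := by linarith
  obtain ⟨hα0, hα1⟩ := hα
  obtain ⟨hη0, hη1⟩ := hη
  set A : ℝ := n * α * k / m with hA
  set q : ℝ := α * (1 - η) * k / m with hq
  have hq0 : 0 ≤ q := by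
    have : 0 ≤ 1 - η := by linarith
    positivity
  have hAγ : α * γ * k ≤ A := by
    rw [hA, le_div_iff₀ hm0]
    have : 0 ≤ α * k := by positivity
    nlinarith
  have hγ' : 28 * Real.log 2 * (1 + η) ≤ α * γ * η ^ 2 := by
    unfold gammaUpper at hγ
    have h := mul_le_mul_of_nonneg_left hγ (show 0 ≤ α * η ^ 2 by positivity)
    field_simp at h
    nlinarith
  have hγ0 : 0 < γ := by
    by_contra hcon
    have : α * γ * η ^ 2 ≤ 0 := by
      have : 0 < α * η ^ 2 := by positivity
      nlinarith
    nlinarith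
  have hsub : overshoot α η P n k ⊆
      {y | A - 1 ≤ ((Finset.univ.filter fun j => y j ∈ {x | P.F0 x ≤ q}).card : ℝ)} := by
    intro y hy
    simp only [overshoot, mem_ofPred_eq] at hy ⊢
    refine le_trans ?_ hy.le
    have : ((n : ℝ) + 1) * (α * k / m) = A + α * k / m := by rw [hA]; ring
    have h0 : 0 ≤ α * k / m := by positivity
    linarith
  refine (measureReal_mono hsub).trans ((chernoff_card P.null
    (measurableSet_le P.measurable_F0 measurable_const) (P.null_F0_le_le hq0)
    -- With `θ = η/2` the exponent is `η/2 - Aη²/4 - Aη³/4`, while the target is at least `-(3/28)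
    -- Aη²`. Since `1/4 - 3/28 = 1/7`, the surplus `Aη²/7 ≥ 4 log 2` pays for `η/2`.
    (θ := η / 2) ⟨by linarith, by linarith⟩ n (A - 1)).trans ?_)
  rw [← Real.rpow_mul_natCast (by norm_num), Real.rpow_def_of_pos (by norm_num), one_div,
    Real.log_inv]
  refine Real.exp_le_exp.2 ?_
  have hnq : n * q = (1 - η) * A := by rw [hq, hA]; ring
  have hr : -Real.log 2 * (3 * γ / gammaUpper α η * k) =
      -(3 / 28 * ((α * γ * k) * η ^ 2) / (1 + η)) := by
    unfold gammaUpper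
    field_simp
  rw [hnq, hr]
  have hAη : 28 * Real.log 2 ≤ A * η ^ 2 := by
    have h1 : α * γ * η ^ 2 ≤ A * η ^ 2 := by
      refine mul_le_mul_of_nonneg_right ?_ (by positivity)
      refine le_trans ?_ hAγ
      exact le_mul_of_one_le_right (by positivity) hk1
    nlinarith
  have h2 : 3 / 28 * ((α * γ * k) * η ^ 2) / (1 + η) ≤ 3 / 28 * (A * η ^ 2) := by
    rw [div_le_iff₀ (by linarith)]
    have h3 : (α * γ * k) * η ^ 2 ≤ A * η ^ 2 := by gcongr
    nlinarith
  have h4 : -(η / 2) * (A - 1) + (1 - η) * A * (η / 2 + (η / 2) ^ 2) =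
      η / 2 - A * η ^ 2 / 4 - A * η ^ 2 * η / 4 := by ring
  rw [h4]
  have h5 : 0 ≤ A * η ^ 2 * η := by
    have : 0 ≤ A * η ^ 2 := by linarith
    positivity
  linarith

/-- With high probability, the semi-supervised BH procedure rejects at least as many false nulls as
the relaxed oracle. -/
lemma measure_TDP_semiBH_lt_le (hα : α ∈ Ioo (0 : ℝ) 1) (hη : η ∈ Ioo (0 : ℝ) 1) {γ : ℝ}
    (hγ : gammaUpper α η ≤ γ) (hγ0 : 0 < gammaUpper α η) (hm : 1 ≤ m) (hnm : (m : ℝ) * γ ≤ n)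
    (P : Model m) :
    (P.law n).real {z | TDP P (semiBH α n m z) < TDP P (oracleBH (α * (1 - η)) P z)} ≤
      (1 / 2 : ℝ) ^ (3 * γ / gammaUpper α η - 1) := by
  set r : ℝ := (1 / 2 : ℝ) ^ (3 * γ / gammaUpper α η) with hr
  have hr0 : 0 < r := Real.rpow_pos_of_pos (by norm_num) _
  -- This bounds the geometric series by `2`, the factor that becomes the `- 1` in the final
  -- exponent.
  have hr2 : r ≤ 1 / 2 := by
    have h1 : 1 ≤ 3 * γ / gammaUpper α η := by
      rw [le_div_iff₀ hγ0]; linarith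
    calc r ≤ (1 / 2 : ℝ) ^ (1 : ℝ) :=
          Real.rpow_le_rpow_of_exponent_ge (by norm_num) (by norm_num) h1
      _ = 1 / 2 := Real.rpow_one _
  have hsub : {z : Sample n m | TDP P (semiBH α n m z) < TDP P (oracleBH (α * (1 - η)) P z)} ⊆
      ⋃ k ∈ Finset.Icc 1 m, overshoot α η P n k ×ˢ (univ : Set (Fin m → ℝ)) := by
    intro z hz
    by_contra hcon
    simp only [mem_iUnion, mem_prod, mem_univ, and_true, exists_prop, Finset.mem_Icc, not_exists,
      not_and] at hcon
    exact absurd (TDP_mono P (oracleBH_subset_semiBH hα.1.le hη.2.le P z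
      fun k h1 h2 => hcon k ⟨h1, h2⟩)) (not_le.2 hz)
  calc (P.law n).real {z | TDP P (semiBH α n m z) < TDP P (oracleBH (α * (1 - η)) P z)}
      ≤ ∑ k ∈ Finset.Icc 1 m,
          (P.law n).real (overshoot α η P n k ×ˢ (univ : Set (Fin m → ℝ))) :=
        (measureReal_mono hsub (measure_ne_top _ _)).trans
          (measureReal_biUnion_finset_le _ _)
    _ ≤ ∑ k ∈ Finset.Icc 1 m, r ^ k := by
        refine Finset.sum_le_sum fun k hk => ?_
        unfold Model.law
        rw [measureReal_prod_prod, probReal_univ, mul_one]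
        exact measure_overshoot_le hα hη hγ hm hnm P (Finset.mem_Icc.1 hk).1
    _ = r * ∑ k ∈ Finset.range m, r ^ k := by
        rw [Finset.mul_sum, Finset.range_eq_Ico, Finset.sum_Ico_eq_sum_range,
          ← Finset.Ico_succ_right_eq_Icc, Finset.sum_Ico_eq_sum_range]
        simp [pow_add]
    _ ≤ r * 2 := by
        refine mul_le_mul_of_nonneg_left ?_ hr0.le
        have h1 : ∑ k ∈ Finset.range m, r ^ k ≤ ∑ k ∈ Finset.range m, (1 / 2 : ℝ) ^ k :=
          Finset.sum_le_sum fun k _ => pow_le_pow_left₀ hr0.le hr2 k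
        exact h1.trans (sum_geometric_two_le m)
    _ = (1 / 2 : ℝ) ^ (3 * γ / gammaUpper α η - 1) := by
        rw [Real.rpow_sub (by norm_num), Real.rpow_one, hr, div_eq_mul_inv _ (1 / 2 : ℝ)]
        norm_num

lemma isMO_semiBH (hα : α ∈ Ioo (0 : ℝ) 1) (hη : η ∈ Ioo (0 : ℝ) 1) {γ : ℝ}
    (hγ : gammaUpper α η ≤ γ) (hγ0 : 0 < gammaUpper α η) :
    IsMO γ α η 0 ((1 / 2 : ℝ) ^ (3 * γ / gammaUpper α η - 1)) (semiBH α) := by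
  refine ⟨isProcedure_semiBH α, fun n m _ _ _ P => ?_, fun n m _ hm hnm P _ =>
    measure_TDP_semiBH_lt_le hα hη hγ hγ0 hm hnm P⟩
  rw [FDR_oracleBH P hα]
  linarith [FDR_semiBH_le (n := n) hα.1.le P]

end Power

/-! ### Products of two-component mixtures. -/

section Mixture

variable {ι : Type*} [Fintype ι] [DecidableEq ι]

/-- A product of two-component mixtures is the mixture of the products, over the random set of the
coordinates that come from the second component. -/
lemma pi_mixture (μ ν : Measure ℝ) [IsProbabilityMeasure μ] [IsProbabilityMeasure ν] (a b : ℝ≥0) :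
    Measure.pi (fun _ : ι => a • μ + b • ν) =
      ∑ S : Finset ι, (b ^ S.card * a ^ (Fintype.card ι - S.card)) •
        Measure.pi (fun i => if i ∈ S then ν else μ) := by
  refine Measure.pi_eq fun s _ => ?_
  have hS : ∀ S : Finset ι, ∀ i, IsProbabilityMeasure (if i ∈ S then ν else μ) := fun S i => by
    split_ifs <;> infer_instance
  simp only [Measure.coe_finsetSum, Finset.sum_apply, Measure.smul_apply, Measure.pi_pi,
    Measure.add_apply]
  simp_rw [add_comm (a • _)]
  rw [Fintype.prod_add]
  refine Finset.sum_congr rfl fun S _ => ?_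
  rw [← Finset.prod_mul_prod_compl S fun i => (if i ∈ S then ν else μ) (s i)]
  have h1 : ∏ i ∈ S, (if i ∈ S then ν else μ) (s i) = ∏ i ∈ S, ν (s i) :=
    Finset.prod_congr rfl fun i hi => by rw [if_pos hi]
  have h2 : ∏ i ∈ Sᶜ, (if i ∈ S then ν else μ) (s i) = ∏ i ∈ Sᶜ, μ (s i) :=
    Finset.prod_congr rfl fun i hi => by rw [if_neg (Finset.mem_compl.1 hi)]
  rw [h1, h2]
  simp only [ENNReal.smul_def, smul_eq_mul, Finset.prod_mul_distrib, Finset.prod_const,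
    Finset.card_compl, ENNReal.coe_mul, ENNReal.coe_pow]
  ring

/-- Only the term `S = ∅`, in which no coordinate is contaminated, is kept. -/
lemma smul_pi_le_pi_mixture (μ ν : Measure ℝ) [IsProbabilityMeasure μ] [IsProbabilityMeasure ν]
    (a b : ℝ≥0) :
    (a ^ Fintype.card ι) • Measure.pi (fun _ : ι => μ) ≤
      Measure.pi (fun _ : ι => a • μ + b • ν) := by
  rw [pi_mixture]
  refine le_trans (le_of_eq ?_) (Finset.single_le_sum (f := fun S : Finset ι =>
    (b ^ S.card * a ^ (Fintype.card ι - S.card)) • Measure.pi (fun i => if i ∈ S then ν else μ))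
    (fun _ _ => Measure.zero_le _) (Finset.mem_univ ∅))
  simp

end Mixture

/-! ### Least favourable models and the basic inequality for mimicking procedures. -/

section Models

/-- The uniform distribution on `[0, 1]`. -/
abbrev unifNull : Measure ℝ := volume.restrict (Icc 0 1)

/-- The uniform distribution on `[2, 3]`. -/
abbrev unifAlt : Measure ℝ := volume.restrict (Icc 2 3)

instance : IsProbabilityMeasure unifNull := ⟨by simp⟩

instance : IsProbabilityMeasure unifAlt := ⟨by simp; norm_num⟩

lemma unifNull_Ici_two : unifNull (Ici 2) = 0 := by
  rw [Measure.restrict_apply measurableSet_Ici]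
  have : Ici (2 : ℝ) ∩ Icc 0 1 = ∅ := by
    ext x; simp only [mem_inter_iff, mem_Ici, mem_Icc, mem_empty_iff_false, iff_false]
    rintro ⟨h1, -, h2⟩; linarith
  rw [this, measure_empty]

lemma ae_unifAlt : ∀ᵐ x ∂unifAlt, (2 : ℝ) ≤ x := by
  filter_upwards [ae_restrict_mem measurableSet_Icc] with x hx using hx.1

lemma unifAlt_ne_unifNull : unifAlt ≠ unifNull := by
  intro h
  have h1 : unifAlt (Ici 2) = 1 := (mem_ae_iff_prob_eq_one measurableSet_Ici).1 ae_unifAlt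
  rw [h, unifNull_Ici_two] at h1
  exact zero_ne_one h1

/-- The model whose false nulls are the indices in `S`, with observations far out in the tail of the
null distribution. -/
def spiked {m : ℕ} (S : Finset (Fin m)) : Model m where
  null := unifNull
  test i := if i ∈ S then unifAlt else unifNull
  null_prob := inferInstance
  test_prob i := by split_ifs <;> infer_instance
  null_cont := inferInstance
  test_cont i := by split_ifs <;> infer_instance

lemma H1_spiked {m : ℕ} (S : Finset (Fin m)) : (spiked S).H1 = S := by
  ext i
  by_cases h : i ∈ S <;> simp [Model.H1, Model.H0, spiked, h, unifAlt_ne_unifNull]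

/-- The distribution of an observation that is in the tail with probability `b`. -/
def contaminated (a b : ℝ≥0) : Measure ℝ := a • unifNull + b • unifAlt

lemma isProbabilityMeasure_contaminated {a b : ℝ≥0} (h : a + b = 1) :
    IsProbabilityMeasure (contaminated a b) := by
  refine ⟨?_⟩
  simp only [contaminated, Measure.add_apply, Measure.smul_apply, measure_univ, ENNReal.smul_def,
    smul_eq_mul, mul_one]
  exact_mod_cast h

lemma nullSingletonClass_contaminated (a b : ℝ≥0) : NullSingletonClass (contaminated a b) :=
  ⟨fun x => by simp [contaminated]⟩

/-- The model in which all nulls are true, with a contaminated null distribution. -/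
def fullNull (m : ℕ) {a b : ℝ≥0} (h : a + b = 1) : Model m where
  null := contaminated a b
  test _ := contaminated a b
  null_prob := isProbabilityMeasure_contaminated h
  test_prob _ := isProbabilityMeasure_contaminated h
  null_cont := nullSingletonClass_contaminated a b
  test_cont _ := nullSingletonClass_contaminated a b

lemma H0_fullNull (m : ℕ) {a b : ℝ≥0} (h : a + b = 1) : (fullNull m h).H0 = Finset.univ := by
  simp [Model.H0, fullNull]

variable {n m : ℕ}

/-- In a spiked model the relaxed oracle rejects all false nulls. -/
lemma ae_subset_oracleBH_spiked {β : ℝ} (hβ : 0 ≤ β) (S : Finset (Fin m)) :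
    ∀ᵐ z ∂((spiked S).law n), S ⊆ oracleBH β (spiked S) z := by
  have h : ∀ i : Fin m, ∀ᵐ z ∂((spiked S).law n), i ∈ S → 2 ≤ z.2 i := by
    intro i
    by_cases hi : i ∈ S
    · have h1 : ∀ᵐ x ∂((spiked S).test i), (2 : ℝ) ≤ x := by
        simpa [spiked, hi] using ae_unifAlt
      have h2 := (Measure.quasiMeasurePreserving_eval (μ := (spiked S).test) i).ae h1
      have h3 : ∀ᵐ z ∂((spiked S).law n), 2 ≤ z.2 i :=
        Measure.quasiMeasurePreserving_snd.ae h2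
      exact h3.mono fun z hz _ => hz
    · exact Filter.Eventually.of_forall fun z hz => absurd hz hi
  filter_upwards [ae_all_iff.2 h] with z hz i hi
  refine mem_BH.2 ?_
  have : (spiked S).F0 (z.2 i) = 0 := by
    have h0 : unifNull (Ici (z.2 i)) = 0 :=
      measure_mono_null (Ici_subset_Ici.2 (hz i hi)) unifNull_Ici_two
    simp [Model.F0, spiked, measureReal_def, h0]
  rw [this]
  positivity

/-- A contaminated full-null sample is, up to the probability that the training sample is hit, a
mixture of samples from the spiked models. -/
lemma sum_spiked_law_le {a b : ℝ≥0} (h : a + b = 1) {E : Set (Sample n m)}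
    (hE : MeasurableSet E) :
    (a : ℝ) ^ n * ∑ S : Finset (Fin m), ((b : ℝ) ^ S.card * (a : ℝ) ^ (m - S.card)) *
      ((spiked S).law n).real E ≤ ((fullNull m h).law n).real E := by
  have hprob : IsProbabilityMeasure (contaminated a b) := isProbabilityMeasure_contaminated h
  have hp : ∀ S : Finset (Fin m), ∀ i, IsProbabilityMeasure
      (if i ∈ S then unifAlt else unifNull) := fun S i => by
    split_ifs <;> infer_instance
  have hle : ((a ^ n) • Measure.pi (fun _ : Fin n => unifNull)).prod
      (Measure.pi fun _ : Fin m => contaminated a b) ≤ (fullNull m h).law n := by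
    refine Measure.prod_mono ?_ le_rfl
    have := smul_pi_le_pi_mixture (ι := Fin n) unifNull unifAlt a b
    rwa [Fintype.card_fin] at this
  have hX := pi_mixture (ι := Fin m) unifNull unifAlt a b
  rw [Fintype.card_fin] at hX
  have key : (a ^ n : ℝ≥0) * ∑ S : Finset (Fin m), ((b ^ S.card * a ^ (m - S.card) : ℝ≥0) : ENNReal) *
      (spiked S).law n E ≤ (fullNull m h).law n E := by
    refine le_trans (le_of_eq ?_) (hle E)
    rw [Measure.prod_smul_left, Measure.smul_apply, ENNReal.smul_def, smul_eq_mul]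
    congr 1
    rw [Measure.prod_apply_symm hE, contaminated, hX, lintegral_finsetSum_measure]
    refine Finset.sum_congr rfl fun S _ => ?_
    rw [lintegral_smul_measure, ← Measure.prod_apply_symm hE]
    rfl
  have := ENNReal.toReal_mono (measure_ne_top _ _) key
  rw [ENNReal.toReal_mul, ENNReal.toReal_sum fun S _ =>
    ENNReal.mul_ne_top ENNReal.coe_ne_top (measure_ne_top _ _)] at this
  simpa [measureReal_def, ENNReal.toReal_mul] using this

/-- With no false null, the FDP is `1` as soon as anything is rejected. -/
lemma FDR_fullNull {a b : ℝ≥0} (h : a + b = 1) {R : Sample n m → Finset (Fin m)}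
    (hR : MeasurableSet {z | R z = ∅}) :
    FDR (fullNull m h) R = ((fullNull m h).law n).real {z | R z = ∅}ᶜ := by
  unfold FDR
  have : ∀ z, FDP (fullNull m h) (R z) = ({z | R z = ∅}ᶜ : Set (Sample n m)).indicator 1 z := by
    intro z
    rw [FDP, H0_fullNull, Finset.univ_inter]
    by_cases hz : R z = ∅
    · simp [hz]
    · have h1 : (1 : ℝ) ≤ (R z).card := by
        exact_mod_cast Finset.card_pos.2 (Finset.nonempty_iff_ne_empty.2 hz)
      rw [max_eq_right h1, div_self (by linarith), indicator_of_mem (by simpa using hz)]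
      rfl
  simp_rw [this]
  exact integral_indicator_one hR.compl

/-- The power requirement forces a rejection in the spiked models. -/
lemma one_sub_le_spiked {β δ : ℝ} (hβ : 0 ≤ β) {S : Finset (Fin m)} (hS : S.Nonempty)
    {R : Sample n m → Finset (Fin m)} (hR : MeasurableSet {z | R z = ∅})
    (h : ((spiked S).law n).real
      {z | TDP (spiked S) (R z) < TDP (spiked S) (oracleBH β (spiked S) z)} ≤ δ) :
    1 - δ ≤ ((spiked S).law n).real {z | R z = ∅}ᶜ := by
  rw [probReal_compl_eq_one_sub hR]
  refine sub_le_sub_left (le_trans ?_ h) 1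
  refine ENNReal.toReal_mono (measure_ne_top _ _) (measure_mono_ae ?_)
  filter_upwards [ae_subset_oracleBH_spiked hβ S] with z hz hzR
  have hzR' : R z = ∅ := hzR
  change TDP (spiked S) (R z) < TDP (spiked S) (oracleBH β (spiked S) z)
  have hc : (0 : ℝ) < S.card := by exact_mod_cast hS.card_pos
  rw [TDP, TDP, hzR', H1_spiked, Finset.inter_empty, Finset.inter_eq_left.2 hz]
  simp only [Finset.card_empty, Nat.cast_zero, zero_div]
  positivity

/-- The basic inequality satisfied by all mimicking procedures. -/
lemma IsMO.le {γ α η δ₁ δ₂ : ℝ} {R : ∀ n m : ℕ, Sample n m → Finset (Fin m)}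
    (h : IsMO γ α η δ₁ δ₂ R) (hα : α ∈ Ioo (0 : ℝ) 1) (hη : η ≤ 1) (hn : 1 ≤ n) (hm : 1 ≤ m)
    (hnm : (m : ℝ) * γ ≤ n) {ε : ℝ} (hε : ε ∈ Icc (0 : ℝ) 1) :
    (1 - ε) ^ n * ((1 - (1 - ε) ^ m) * (1 - δ₂)) ≤ α + δ₁ := by
  obtain ⟨hproc, hfdr, hpow⟩ := h
  have hε1 : 0 ≤ 1 - ε := by linarith [hε.2]
  let a : ℝ≥0 := ⟨1 - ε, hε1⟩
  let b : ℝ≥0 := ⟨ε, hε.1⟩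
  have hab : a + b = 1 := by
    apply NNReal.coe_injective
    change 1 - ε + ε = 1
    ring
  have ha : (a : ℝ) = 1 - ε := rfl
  have hb : (b : ℝ) = ε := rfl
  have hR := hproc n m ∅
  have h1 := hfdr n m hn hm hnm (fullNull m hab)
  have hm0 : (m : ℝ) ≠ 0 := by exact_mod_cast (by omega : m ≠ 0)
  rw [FDR_oracleBH _ hα, H0_fullNull, FDR_fullNull hab hR, Finset.card_univ, Fintype.card_fin,
    mul_div_cancel₀ _ hm0] at h1
  have h2 := sum_spiked_law_le (n := n) hab hR.compl
  rw [ha, hb] at h2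
  refine le_trans ?_ (h2.trans (by linarith))
  refine mul_le_mul_of_nonneg_left ?_ (pow_nonneg hε1 n)
  have hsum : ∑ S : Finset (Fin m), ε ^ S.card * (1 - ε) ^ (m - S.card) = 1 := by
    have := Fintype.sum_pow_mul_eq_add_pow (Fin m) ε (1 - ε)
    simpa using this
  -- The spiked model with `S = ∅` has no false null and carries no power requirement; dropping it
  -- leaves total weight `1 - (1 - ε) ^ m`.
  rw [← Finset.sum_erase_add _ _ (Finset.mem_univ ∅)] at hsum ⊢
  simp only [Finset.card_empty, pow_zero, one_mul, Nat.sub_zero] at hsum ⊢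
  have hlast : 0 ≤ (1 - ε) ^ m * ((spiked (∅ : Finset (Fin m))).law n).real {z | R n m z = ∅}ᶜ := by
    positivity
  refine le_trans ?_ (le_add_of_nonneg_right hlast)
  rw [← eq_sub_iff_add_eq.2 hsum, Finset.sum_mul]
  refine Finset.sum_le_sum fun S hS => ?_
  have hSne : S.Nonempty := Finset.nonempty_iff_ne_empty.2 (Finset.ne_of_mem_erase hS)
  refine mul_le_mul_of_nonneg_left ?_ (mul_nonneg (pow_nonneg hε.1 _) (pow_nonneg hε1 _))
  refine one_sub_le_spiked (β := α * (1 - η)) (mul_nonneg hα.1.le (by linarith)) hSne hR ?_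
  refine hpow n m hn hm hnm (spiked S) ?_
  rw [H1_spiked]
  exact hSne.card_pos

end Models

/-! ### Choice of parameters that rules out mimicking. -/

section Constants

variable {α η γ : ℝ}

lemma gammaUpper_pos (hα : 0 < α) (hη : 0 < η) : 0 < gammaUpper α η := by
  have := Real.log_pos one_lt_two
  unfold gammaUpper
  positivity

lemma gammaLower_pos (hα : 0 ≤ α) (hη : η ≤ 1) : 0 < gammaLower α η := by
  have : 0 ≤ α * (1 - η) := mul_nonneg hα (by linarith)
  unfold gammaLower
  positivity

/-- From `α(1 - η) ≤ 1/4` the base `1 + (α(1 - η)) ^ (-1/2)` is at least `3`, and `3³ · 64 = 12³`.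
Apart from its positivity, this is all that the impossibility proof needs about `gammaLower`. -/
lemma gammaLower_le (hα : α ∈ Ioo (0 : ℝ) (1 / 4)) (hη : η ∈ Ioo (0 : ℝ) 1) :
    gammaLower α η ≤ (1 / 12) ^ 3 := by
  have h0 : 0 < α * (1 - η) := mul_pos hα.1 (by linarith [hη.2])
  have h1 : α * (1 - η) ≤ 1 / 4 := by nlinarith [hα.1, hα.2, hη.1]
  have h2 : (2 : ℝ) ≤ (α * (1 - η)) ^ (-(1 / 2) : ℝ) := by
    calc (2 : ℝ) = ((1 / 2 : ℝ) ^ (2 : ℝ)) ^ (-(1 / 2) : ℝ) := by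
          rw [← Real.rpow_mul (by norm_num)]
          norm_num [Real.rpow_neg_one]
      _ = (1 / 4 : ℝ) ^ (-(1 / 2) : ℝ) := by norm_num
      _ ≤ _ := Real.rpow_le_rpow_of_nonpos h0 h1 (by norm_num)
  unfold gammaLower
  calc ((1 + (α * (1 - η)) ^ (-(1 / 2) : ℝ)) ^ 3)⁻¹ / 64 ≤ ((1 + 2) ^ 3)⁻¹ / 64 := by gcongr
    _ = (1 / 12) ^ 3 := by norm_num

lemma not_isMO {δ₁ δ₂ : ℝ} (hα : α ∈ Ioo (0 : ℝ) (1 / 4)) (hη : η ∈ Ioo (0 : ℝ) 1) (hγ : 0 < γ)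
    (hlt : γ < gammaLower α η) (hδ₁ : δ₁ < 1 / 2 - α)
    (hδ₂ : δ₂ < 1 / 2 - (1 / 4) * (γ / gammaLower α η) ^ (1 / 3 : ℝ))
    (R : ∀ n m : ℕ, Sample n m → Finset (Fin m)) : ¬ IsMO γ α η δ₁ δ₂ R := by
  intro hMO
  have hL0 := gammaLower_pos hα.1.le hη.2.le
  have hL := gammaLower_le hα hη
  -- Everything is expressed in `x = γ^{1/3} < 1/12`; the hypothesis on `δ₂` then gives `1 - δ₂ > (1
  -- + 6x)/2`.
  obtain ⟨x, hx0, hxγ⟩ : ∃ x : ℝ, 0 < x ∧ x ^ 3 = γ :=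
    ⟨γ ^ ((3 : ℕ) : ℝ)⁻¹, Real.rpow_pos_of_pos hγ _, Real.rpow_inv_natCast_pow hγ.le (by norm_num)⟩
  have hx12 : x < 1 / 12 := by
    refine lt_of_pow_lt_pow_left₀ 3 (by norm_num) ?_
    rw [hxγ]; exact hlt.trans_le hL
  have hroot : 12 * x ≤ (γ / gammaLower α η) ^ (1 / 3 : ℝ) := by
    calc 12 * x = ((12 * x) ^ 3) ^ (((3 : ℕ) : ℝ)⁻¹) :=
          (Real.pow_rpow_inv_natCast (by positivity) (by norm_num)).symm
      _ = ((12 * x) ^ 3) ^ (1 / 3 : ℝ) := by norm_num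
      _ ≤ (γ / gammaLower α η) ^ (1 / 3 : ℝ) := by
          refine Real.rpow_le_rpow (by positivity) ?_ (by norm_num)
          rw [le_div_iff₀ hL0, mul_pow, hxγ]
          nlinarith
  -- So large an `m` makes `mγ ≥ 1`, hence `ε ≤ x²` below, which keeps the cost of rounding `n` up
  -- to an integer at `x²`.
  set m : ℕ := ⌈(x ^ 3)⁻¹⌉₊ with hm
  have hm1 : 1 ≤ m := Nat.ceil_pos.2 (by positivity)
  have hm0 : (0 : ℝ) < m := by exact_mod_cast hm1
  have hmx : 1 ≤ m * x ^ 3 := by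
    have h := Nat.le_ceil (x ^ 3)⁻¹
    rw [← hm, inv_le_iff_one_le_mul₀ (by positivity)] at h
    exact h
  set n : ℕ := ⌈(m : ℝ) * γ⌉₊ with hn
  have hn1 : 1 ≤ n := Nat.ceil_pos.2 (by positivity)
  have hnle : (n : ℝ) ≤ m * x ^ 3 + 1 := by
    rw [hxγ]; exact (Nat.ceil_lt_add_one (by positivity)).le
  -- Balances the two errors: `mε = 1/x` is large, so a test point is contaminated with probability
  -- at least `1/(1 + x)`, while `nε ≤ 2x²` is small.
  set ε : ℝ := (x * m)⁻¹ with hε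
  have hε0 : 0 < ε := by positivity
  have hεx : ε ≤ x ^ 2 := by
    rw [hε, inv_le_iff_one_le_mul₀ (by positivity)]
    linarith
  have hxsq : x ^ 2 ≤ x / 12 := by nlinarith
  have hmain := hMO.le (n := n) (m := m) ⟨hα.1, by linarith [hα.2]⟩ hη.2.le hn1 hm1
    (Nat.le_ceil _) ⟨hε0.le, by linarith⟩
  have hpn : 1 - 2 * x ^ 2 ≤ (1 - ε) ^ n := by
    have h1 := one_add_mul_le_pow (a := -ε) (by linarith) n
    have h2 : n * ε ≤ 2 * x ^ 2 := by
      calc n * ε ≤ (m * x ^ 3 + 1) * ε := by gcongr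
        _ = x ^ 2 + ε := by rw [hε]; field_simp
        _ ≤ 2 * x ^ 2 := by linarith
    rw [← sub_eq_add_neg] at h1
    linarith
  have hpm : (1 + x)⁻¹ ≤ 1 - (1 - ε) ^ m := by
    have h1 : (1 - ε) ^ m ≤ Real.exp (-x⁻¹) := by
      calc (1 - ε) ^ m ≤ (Real.exp (-ε)) ^ m :=
            pow_le_pow_left₀ (by linarith) (Real.one_sub_le_exp_neg ε) m
        _ = Real.exp (-x⁻¹) := by
            rw [← Real.exp_nat_mul, hε]
            congr 1
            field_simp
    have h2 : Real.exp (-x⁻¹) ≤ (1 + x⁻¹)⁻¹ := by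
      rw [Real.exp_neg]
      refine inv_anti₀ (by positivity) ?_
      linarith [Real.add_one_le_exp x⁻¹]
    have h3 : (1 + x⁻¹)⁻¹ = 1 - (1 + x)⁻¹ := by field_simp; ring
    linarith
  have hδ : (1 + 6 * x) / 2 < 1 - δ₂ := by linarith
  have hx1 : 0 < 1 - 2 * x ^ 2 := by nlinarith
  have hlow : (1 - 2 * x ^ 2) * ((1 + x)⁻¹ * ((1 + 6 * x) / 2)) ≤
      (1 - ε) ^ n * ((1 - (1 - ε) ^ m) * (1 - δ₂)) := by
    have : 0 ≤ (1 - ε) ^ n := hx1.le.trans hpn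
    have : 0 ≤ 1 - (1 - ε) ^ m := le_trans (by positivity) hpm
    gcongr
  -- Amounts to `5x - 2x² - 12x³ ≥ 0`, true for `x < 1/12`. It contradicts `hmain`, because `α + δ₁
  -- < 1/2`.
  have hfin : 1 / 2 ≤ (1 - 2 * x ^ 2) * ((1 + x)⁻¹ * ((1 + 6 * x) / 2)) := by
    have h1 : (1 - 2 * x ^ 2) * ((1 + x)⁻¹ * ((1 + 6 * x) / 2)) =
        ((1 - 2 * x ^ 2) * (1 + 6 * x) / 2) / (1 + x) := by field_simp
    rw [h1, le_div_iff₀ (by linarith)]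
    nlinarith [mul_pos hx0 hx1]
  linarith

end Constants

end SemiSupervised
end

theorem corollary6 (α η γ : ℝ) (hα : α ∈ Set.Ioo (0 : ℝ) (1 / 4)) (hη : η ∈ Set.Ioo (0 : ℝ) 1)
    (hγ : 0 < γ) :
    (γ < SemiSupervised.gammaLower α η →
      (∀ δ₁ ∈ Set.Ioc (0 : ℝ) (1 / 4), ∀ δ₂ ∈ Set.Ioc (0 : ℝ) (1 / 4),
        ¬ ∃ R : ∀ n m : ℕ, SemiSupervised.Sample n m → Finset (Fin m),
          SemiSupervised.IsMO γ α η δ₁ δ₂ R) ∧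
      (∀ δ₁ δ₂ : ℝ, δ₁ < 1 / 2 - α →
        δ₂ < 1 / 2 - (1 / 4) * (γ / SemiSupervised.gammaLower α η) ^ (1 / 3 : ℝ) →
        ¬ ∃ R : ∀ n m : ℕ, SemiSupervised.Sample n m → Finset (Fin m),
          SemiSupervised.IsMO γ α η δ₁ δ₂ R)) ∧
    (SemiSupervised.gammaUpper α η ≤ γ →
      (∃ δ₁ ∈ Set.Icc (0 : ℝ) (1 / 4), ∃ δ₂ ∈ Set.Icc (0 : ℝ) (1 / 4),
        ∃ R : ∀ n m : ℕ, SemiSupervised.Sample n m → Finset (Fin m),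
          SemiSupervised.IsMO γ α η δ₁ δ₂ R) ∧
      SemiSupervised.IsMO γ α η 0 ((1 / 2 : ℝ) ^ (3 * γ / SemiSupervised.gammaUpper α η - 1))
        (SemiSupervised.semiBH α)) := by
  refine ⟨fun hlt => ⟨?_, ?_⟩, fun hle => ?_⟩
  · rintro δ₁ hδ₁ δ₂ hδ₂ ⟨R, hR⟩
    have hL0 := SemiSupervised.gammaLower_pos hα.1.le hη.2.le
    -- Hence the general bound on `δ₂` exceeds `1/4`, as does `1/2 - α`, and the range `(0, 1/4]` is
    -- covered.
    have h1 : (γ / SemiSupervised.gammaLower α η) ^ (1 / 3 : ℝ) < 1 :=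
      Real.rpow_lt_one (by positivity) ((div_lt_one hL0).2 hlt) (by norm_num)
    exact SemiSupervised.not_isMO hα hη hγ hlt (by linarith [hδ₁.2, hα.2])
      (by linarith [hδ₂.2]) R hR
  · rintro δ₁ δ₂ hδ₁ hδ₂ ⟨R, hR⟩
    exact SemiSupervised.not_isMO hα hη hγ hlt hδ₁ hδ₂ R hR
  · have hU0 := SemiSupervised.gammaUpper_pos hα.1 hη.1
    have hMO := SemiSupervised.isMO_semiBH (α := α) ⟨hα.1, by linarith [hα.2]⟩ hη hle hU0
    refine ⟨⟨0, by norm_num, _, ⟨by positivity, ?_⟩, _, hMO⟩, hMO⟩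
    have h2 : 2 ≤ 3 * γ / SemiSupervised.gammaUpper α η - 1 := by
      have : 3 ≤ 3 * γ / SemiSupervised.gammaUpper α η := by
        rw [le_div_iff₀ hU0]; linarith
      linarith
    calc (1 / 2 : ℝ) ^ (3 * γ / SemiSupervised.gammaUpper α η - 1) ≤ (1 / 2 : ℝ) ^ (2 : ℝ) :=
          Real.rpow_le_rpow_of_exponent_ge (by norm_num) (by norm_num) h2
      _ = 1 / 4 := by norm_num
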